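/- Let $r\ge 2$, $k\ge 1$ and $t\ge 1$ be integers with $k\ge t-3$, and let $G$ be a finite simple graph on $n$ vertices with $$(r-1)(t-1)k<n\le (r-1)(t-1)(k+1)$$ and minimum degree $$\delta(G)\ \ge\ n-\left\lceil \frac{k}{k+1}\left\lceil \frac{n}{r-1}\right\rceil\right\rceil .$$ Then $G\rightarrow(K_r,P_t)$; that is, every colouring of the edges of $G$ with the colours red and blue contains a red copy of the complete graph $K_r$ on $r$ vertices or a blue copy of the path $P_t$ on $t$ vertices, as a (not necessarily induced) subgraph. -/

import Mathlib

/-- `G → (H₁, H₂)`: every colouring of the edges of `G` with the two colours red (`true`) and blue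
(`false`) contains a red copy of `H₁` or a blue copy of `H₂` (as a subgraph, not necessarily
induced). -/
def RamseyArrow {V α β : Type*} (G : SimpleGraph V) (H₁ : SimpleGraph α) (H₂ : SimpleGraph β) :
    Prop :=
  ∀ C : G.EdgeLabeling Bool,
    H₁.IsContained (C.labelGraph true) ∨ H₂.IsContained (C.labelGraph false)

/-! Put `q = t - 1`, `d = ⌈n/(r-1)⌉ - 1`, and let `D` be the outer ceiling, so each vertex misses at
most `D` vertices of `G`, itself included. If there is no blue `P_t`, every `S` contains a red
clique of size at least `|S|/d` (`exists_clique_of_pathFree`); as `n > d(r-1)`, this gives a red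
`K_r`. Induct on `S`. A vertex with at most `d` red non-neighbours in `S` joins the clique found
after deleting them. Otherwise all blue degrees are at least `d + 1 - D`. If this is at least `q`, a
blue path on `q + 1` vertices grows greedily. The remaining case is blue degree at least `q - 1`
with `q ∤ d + 1` (`ceil_arithmetic`): blue is then a disjoint union of `K_q`'s, the complement of
red is `d`-regular, and a Brooks-type argument with divisibility by `q` applies
(`exists_clique_of_regular`). -/

/-- The vertices of `S` that equal `v` or are not adjacent to `v`. -/
noncomputable def nonNbr {V : Type*} (R : SimpleGraph V) (S : Finset V) (v : V) : Finset V :=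
  open Classical in {u ∈ S | ¬ R.Adj v u}

/-- The neighbours of `v` in `S`. -/
noncomputable def nbrIn {V : Type*} (B : SimpleGraph V) (S : Finset V) (v : V) : Finset V :=
  open Classical in {u ∈ S | B.Adj v u}

/-- The vertices of `S` that are not adjacent to all of `J`. -/
noncomputable def nonNbrs {V : Type*} (R : SimpleGraph V) (S J : Finset V) : Finset V :=
  open Classical in {u ∈ S | ∃ v ∈ J, ¬ R.Adj v u}

section

variable {V : Type*} {R B : SimpleGraph V} {S J : Finset V} {u v : V}

lemma mem_nonNbr : u ∈ nonNbr R S v ↔ u ∈ S ∧ ¬ R.Adj v u := by simp [nonNbr]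

lemma mem_nbrIn : u ∈ nbrIn B S v ↔ u ∈ S ∧ B.Adj v u := by simp [nbrIn]

lemma mem_nonNbrs : u ∈ nonNbrs R S J ↔ u ∈ S ∧ ∃ v ∈ J, ¬ R.Adj v u := by simp [nonNbrs]

/-! ### Paths as lists -/

/-- A list of distinct vertices, consecutive ones adjacent, all in `S`. -/
def IsPathList (B : SimpleGraph V) (S : Finset V) (l : List V) : Prop :=
  l.IsChain B.Adj ∧ l.Nodup ∧ ∀ x ∈ l, x ∈ S

lemma IsPathList.reverse {l : List V} (h : IsPathList B S l) : IsPathList B S l.reverse := by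
  refine ⟨?_, List.nodup_reverse.2 h.2.1, fun x hx => h.2.2 x (List.mem_reverse.1 hx)⟩
  rw [List.isChain_reverse]
  exact h.1.imp fun a b hab => hab.symm

lemma IsPathList.cons {a z : V} {l : List V} (h : IsPathList B S (a :: l)) (hz : z ∈ S)
    (haz : B.Adj a z) (hzl : z ∉ a :: l) : IsPathList B S (z :: a :: l) := by
  refine ⟨List.isChain_cons_cons.2 ⟨haz.symm, h.1⟩, List.nodup_cons.2 ⟨hzl, h.2.1⟩, ?_⟩
  intro x hx
  rcases List.mem_cons.1 hx with rfl | hx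
  · exact hz
  · exact h.2.2 x hx

/-- Greedy extension at the head: the rest of a path on at most `m` vertices cannot contain all `m`
neighbours of its head. -/
lemma IsPathList.exists_append {m : ℕ} (hdeg : ∀ v ∈ S, m ≤ (nbrIn B S v).card) {l : List V}
    (h : IsPathList B S l) (hne : l ≠ []) (hl : l.length ≤ m + 1) :
    ∃ p, IsPathList B S (p ++ l) ∧ (p ++ l).length = m + 1 := by
  classical
  induction hk : m + 1 - l.length generalizing l with
  | zero => exact ⟨[], by simpa using h, by simp; omega⟩
  | succ k ih =>
    obtain ⟨a, l', rfl⟩ := List.exists_cons_of_ne_nil hne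
    obtain ⟨z, hz, hzl⟩ : ∃ z ∈ nbrIn B S a, z ∉ l'.toFinset := by
      refine Finset.exists_mem_notMem_of_card_lt_card ?_
      have h1 := List.toFinset_card_le l'
      have h2 := hdeg a (h.2.2 a (by simp))
      simp only [List.length_cons] at hk
      omega
    rw [mem_nbrIn] at hz
    have hz' : z ∉ a :: l' := by
      rw [List.mem_cons, not_or]
      exact ⟨hz.2.ne', by simpa using hzl⟩
    obtain ⟨p, hp, hpl⟩ := ih (h.cons hz.1 hz.2 hz') (by simp) (by simp at hk ⊢; omega)
      (by simp at hk ⊢; omega)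
    exact ⟨p ++ [z], by simpa using hp, by simpa using hpl⟩

lemma isPathList_singleton (hv : v ∈ S) : IsPathList B S [v] :=
  ⟨List.isChain_singleton v, List.nodup_singleton v, by simpa using hv⟩

lemma IsPathList.pathGraph_isContained {l : List V} (h : IsPathList B S l) :
    (SimpleGraph.pathGraph l.length).IsContained B := by
  refine ⟨⟨⟨fun i => l[i], ?_⟩, ?_⟩⟩
  · intro i j hij
    have hc := List.isChain_iff_getElem.1 h.1
    rw [SimpleGraph.pathGraph_adj] at hij
    rcases hij with hij | hij
    · have := hc i (by omega)
      simpa [hij] using this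
    · have := (hc j (by omega)).symm
      simpa [hij] using this
  · intro i j hij
    exact Fin.ext ((List.Nodup.getElem_inj_iff h.2.1).1 hij)

/-! ### Path-free graphs of minimum degree `q - 1` -/

/-- In a graph without paths of `q + 1` vertices, the head of a path of `q` vertices has all its
neighbours on the path. -/
lemma IsPathList.nbrIn_head [DecidableEq V] {q : ℕ} {a : V} {l : List V}
    (hfree : ∀ l, IsPathList B S l → l.length ≠ q + 1)
    (hdeg : q - 1 ≤ (nbrIn B S a).card) (h : IsPathList B S (a :: l))
    (hl : (a :: l).length = q) : nbrIn B S a = l.toFinset := by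
  refine Finset.eq_of_subset_of_card_le ?_ ?_
  · intro z hz
    rw [mem_nbrIn] at hz
    by_contra hzl
    refine hfree _ (h.cons hz.1 hz.2 ?_) (by simp at hl ⊢; omega)
    rw [List.mem_cons, not_or]
    exact ⟨hz.2.ne', by simpa using hzl⟩
  · have := List.toFinset_card_le l
    simp only [List.length_cons] at hl
    omega

lemma card_nbrIn_of_pathFree {q : ℕ} (hq : 2 ≤ q)
    (hfree : ∀ l, IsPathList B S l → l.length ≠ q + 1)
    (hdeg : ∀ v ∈ S, q - 1 ≤ (nbrIn B S v).card) (hv : v ∈ S) : (nbrIn B S v).card = q - 1 := by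
  classical
  obtain ⟨p, hp, hpl⟩ := (isPathList_singleton hv).exists_append hdeg (by simp) (by simp)
  have h := hp.reverse
  simp only [List.reverse_append, List.reverse_singleton, List.singleton_append] at h
  simp only [List.length_append, List.length_singleton] at hpl
  rw [h.nbrIn_head hfree (hdeg v hv) (by simp; omega),
    List.toFinset_card_of_nodup (List.nodup_cons.1 h.2.1).2, List.length_reverse]
  omega

/-- Extend `w, v, u` beyond `w` to `q` vertices; the end `u` is then adjacent to everything else on
the path, including `w`. -/
lemma adj_trans_of_pathFree {q : ℕ} (hq : 2 ≤ q)
    (hfree : ∀ l, IsPathList B S l → l.length ≠ q + 1)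
    (hdeg : ∀ v ∈ S, q - 1 ≤ (nbrIn B S v).card) {w : V} (hu : u ∈ S) (hv : v ∈ S) (hw : w ∈ S)
    (huv : B.Adj v u) (hvw : B.Adj v w) (huw : u ≠ w) : B.Adj u w := by
  classical
  have h3 : IsPathList B S [w, v, u] := by
    refine ((isPathList_singleton hu).cons hv huv.symm ?_).cons hw hvw ?_
    · simpa using huv.ne
    · simpa using ⟨hvw.ne', huw.symm⟩
  have hq3 : 3 ≤ q := by
    by_contra hlt
    exact hfree _ h3 (by simp; omega)
  obtain ⟨p, hp, hpl⟩ := h3.exists_append hdeg (by simp) (by simp; omega)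
  have h := hp.reverse
  simp only [List.reverse_append, List.reverse_cons, List.reverse_nil, List.nil_append,
    List.cons_append] at h
  simp only [List.length_append, List.length_cons, List.length_nil] at hpl
  have := h.nbrIn_head hfree (hdeg u hu) (by simp; omega)
  have hmem : w ∈ nbrIn B S u := by rw [this]; simp
  exact (mem_nbrIn.1 hmem).2

/-- If adjacency in `S` is transitive and `(q - 1)`-regular, then `q` divides the size of
every union of connected components. -/
lemma dvd_card_of_closed {q : ℕ} (hq : 2 ≤ q)
    (hcard : ∀ v ∈ S, (nbrIn B S v).card = q - 1)
    (htrans : ∀ u ∈ S, ∀ v ∈ S, ∀ w ∈ S, B.Adj v u → B.Adj v w → u ≠ w → B.Adj u w)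
    {T : Finset V} (hT : T ⊆ S) (hcl : ∀ v ∈ T, ∀ u ∈ S, B.Adj v u → u ∈ T) : q ∣ T.card := by
  classical
  induction T using Finset.strongInduction with
  | H T ih =>
    rcases T.eq_empty_or_nonempty with rfl | ⟨v, hv⟩
    · simp
    set C := insert v (nbrIn B S v) with hC
    have hCT : C ⊆ T := by
      intro x hx
      rcases Finset.mem_insert.1 hx with rfl | hx
      · exact hv
      · exact hcl v hv x (mem_nbrIn.1 hx).1 (mem_nbrIn.1 hx).2
    have hCc : C.card = q := by
      rw [hC, Finset.card_insert_of_notMem (by simp [mem_nbrIn]), hcard v (hT hv)]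
      omega
    have hvC : v ∈ C := Finset.mem_insert_self _ _
    have hlt : T \ C ⊂ T :=
      Finset.ssubset_iff_subset_ne.2 ⟨Finset.sdiff_subset, fun h => by
        rw [← h] at hv
        exact (Finset.mem_sdiff.1 hv).2 hvC⟩
    have hd := ih (T \ C) hlt (Finset.sdiff_subset.trans hT) (by
      intro x hx y hy hxy
      rw [Finset.mem_sdiff] at hx ⊢
      refine ⟨hcl x hx.1 y hy hxy, fun hyC => hx.2 ?_⟩
      by_cases hxv : x = v
      · exact hxv ▸ hvC
      refine Finset.mem_insert_of_mem (mem_nbrIn.2 ⟨hT hx.1, ?_⟩)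
      rcases Finset.mem_insert.1 hyC with rfl | hyC
      · exact hxy.symm
      · exact (htrans x (hT hx.1) y hy v (hT hv) hxy.symm (mem_nbrIn.1 hyC).2.symm hxv).symm)
    have := Finset.card_sdiff_add_card_eq_card hCT
    rw [← this, hCc]
    exact dvd_add hd dvd_rfl

end

/-! ### Building red cliques -/

section

variable {V : Type*} {R B : SimpleGraph V} {S : Finset V} {d : ℕ}

lemma exists_clique_union {A A' : Finset V} [DecidableEq V] (hA : A ⊆ S) (hA' : A' ⊆ S)
    (hadj : ∀ x ∈ A, ∀ y ∈ A', R.Adj x y) (hclA : R.IsClique (A : Set V))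
    (hclA' : R.IsClique (A' : Set V)) :
    A ∪ A' ⊆ S ∧ R.IsClique ((A ∪ A' : Finset V) : Set V) ∧
      (A ∪ A').card = A.card + A'.card := by
  refine ⟨Finset.union_subset hA hA', ?_, Finset.card_union_of_disjoint ?_⟩
  · intro x hx y hy hxy
    simp only [Finset.coe_union, Set.mem_union, Finset.mem_coe] at hx hy
    rcases hx with hx | hx <;> rcases hy with hy | hy
    · exact hclA hx hy hxy
    · exact hadj x hx y hy
    · exact (hadj y hy x hx).symm
    · exact hclA' hx hy hxy
  · rw [Finset.disjoint_left]
    exact fun x hx hx' => (hadj x hx x hx').ne rfl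

lemma subset_nonNbrs {J : Finset V} (hJ : J ⊆ S) : J ⊆ nonNbrs R S J := fun x hx =>
  mem_nonNbrs.2 ⟨hJ hx, x, hx, R.loopless.irrefl x⟩

lemma nonNbrs_subset {J : Finset V} : nonNbrs R S J ⊆ S := fun _ hx => (mem_nonNbrs.1 hx).1

/-- `J` is completely joined to what remains after deleting `nonNbrs R S J`, which costs at most `d`
vertices per vertex of `J`. -/
lemma exists_clique_of_card_nonNbrs_le {J : Finset V}
    (ih : ∀ S' ⊂ S, ∃ Q ⊆ S', R.IsClique (Q : Set V) ∧ S'.card ≤ d * Q.card)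
    (hJ : J ⊆ S) (hne : J.Nonempty) (hcl : R.IsClique (J : Set V))
    (hcard : (nonNbrs R S J).card ≤ d * J.card) :
    ∃ Q ⊆ S, R.IsClique (Q : Set V) ∧ S.card ≤ d * Q.card := by
  classical
  obtain ⟨v, hv⟩ := hne
  obtain ⟨Q, hQ, hQcl, hQc⟩ := ih (S \ nonNbrs R S J) (Finset.ssubset_iff_subset_ne.2
    ⟨Finset.sdiff_subset, fun h => by
      have := hJ hv
      rw [← h] at this
      exact (Finset.mem_sdiff.1 this).2 (subset_nonNbrs hJ hv)⟩)
  obtain ⟨h1, h2, h3⟩ := exists_clique_union (R := R) (S := S) hJ (hQ.trans Finset.sdiff_subset) (by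
    intro x hx y hy
    have hy' := Finset.mem_sdiff.1 (hQ hy)
    by_contra hxy
    exact hy'.2 (mem_nonNbrs.2 ⟨hy'.1, x, hx, hxy⟩)) hcl hQcl
  refine ⟨_, h1, h2, ?_⟩
  have := Finset.card_sdiff_add_card_eq_card (nonNbrs_subset (R := R) (S := S) (J := J))
  rw [h3, mul_add]
  omega

/-- The critical case: the complement of `R` is `d`-regular on `S`, and contains a spanning
disjoint union of cliques of size `q`, given by `B`, where `q` does not divide `d + 1`. -/
lemma exists_clique_of_regular {q : ℕ} (hq : 2 ≤ q) (hqd : ¬ q ∣ d + 1)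
    (hne : S.Nonempty)
    (ih : ∀ S' ⊂ S, ∃ Q ⊆ S', R.IsClique (Q : Set V) ∧ S'.card ≤ d * Q.card)
    (hBR : ∀ u v, B.Adj u v → ¬ R.Adj u v)
    (hreg : ∀ v ∈ S, (nonNbr R S v).card = d + 1)
    (hcard : ∀ v ∈ S, (nbrIn B S v).card = q - 1)
    (htrans : ∀ u ∈ S, ∀ v ∈ S, ∀ w ∈ S, B.Adj v u → B.Adj v w → u ≠ w → B.Adj u w) :
    ∃ Q ⊆ S, R.IsClique (Q : Set V) ∧ S.card ≤ d * Q.card := by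
  classical
  by_contra hno
  have hbig : ∀ J ⊆ S, J.Nonempty → R.IsClique (J : Set V) → d * J.card < (nonNbrs R S J).card := by
    intro J hJ hJne hcl
    by_contra hle
    exact hno (exists_clique_of_card_nonNbrs_le ih hJ hJne hcl (not_lt.1 hle))
  have hno' : ∀ Q ⊆ S, R.IsClique (Q : Set V) → d * Q.card < S.card := by
    intro Q hQ hcl
    by_contra hle
    exact hno ⟨Q, hQ, hcl, not_lt.1 hle⟩
  have hdvd : ∀ T ⊆ S, (∀ v ∈ T, ∀ u ∈ S, B.Adj v u → u ∈ T) → q ∣ T.card :=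
    fun T hT hcl => dvd_card_of_closed hq hcard htrans hT hcl
  have hqS : q ∣ S.card := hdvd S subset_rfl fun _ _ u hu _ => hu
  -- The complement of `R` is connected on `S`: otherwise the inductive cliques of two completely
  -- joined parts would unite.
  have hconn : ∀ A ⊂ S, A.Nonempty → ∃ w ∈ S \ A, ∃ x ∈ A, ¬ R.Adj x w := by
    intro A hA hAne
    by_contra hcon
    push Not at hcon
    obtain ⟨Q, hQ, hQcl, hQc⟩ := ih A hA
    obtain ⟨Q', hQ', hQcl', hQc'⟩ := ih (S \ A) (Finset.sdiff_ssubset hA.1 hAne)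
    obtain ⟨h1, h2, h3⟩ := exists_clique_union (R := R) (S := S) (hQ.trans hA.1)
      (hQ'.trans Finset.sdiff_subset) (fun x hx y hy => hcon y (hQ' hy) x (hQ hx)) hQcl hQcl'
    have h4 := hno' _ h1 h2
    have h5 := Finset.card_sdiff_add_card_eq_card hA.1
    rw [h3, mul_add] at h4
    omega
  have hinsert : ∀ J ⊆ S, R.IsClique (J : Set V) → ∀ w ∈ S \ nonNbrs R S J,
      insert w J ⊆ S ∧ R.IsClique ((insert w J : Finset V) : Set V) ∧
        (insert w J).card = J.card + 1 := by
    intro J hJ hcl w hw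
    rw [Finset.mem_sdiff] at hw
    refine ⟨Finset.insert_subset hw.1 hJ, ?_,
      Finset.card_insert_of_notMem fun h => hw.2 (subset_nonNbrs hJ h)⟩
    rw [Finset.coe_insert, SimpleGraph.isClique_insert]
    refine ⟨hcl, fun b hb _ => ?_⟩
    by_contra hwb
    exact hw.2 (mem_nonNbrs.2 ⟨hw.1, b, hb, fun h => hwb h.symm⟩)
  have hd : 1 ≤ d := by
    obtain ⟨v, hv⟩ := hne
    have h1 : insert v (nbrIn B S v) ⊆ nonNbr R S v := by
      intro x hx
      rcases Finset.mem_insert.1 hx with rfl | hx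
      · exact mem_nonNbr.2 ⟨hv, R.loopless.irrefl x⟩
      · exact mem_nonNbr.2 ⟨(mem_nbrIn.1 hx).1, hBR _ _ (mem_nbrIn.1 hx).2⟩
    have h2 := Finset.card_le_card h1
    rw [Finset.card_insert_of_notMem (by simp [mem_nbrIn]), hcard v hv, hreg v hv] at h2
    omega
  -- A singleton qualifies: it has `d + 1` non-neighbours, and `q` divides `|S|` but not `d + 1`.
  obtain ⟨J, hJmem, hJmax⟩ := Finset.exists_max_image
    (S.powerset.filter fun J : Finset V => J.Nonempty ∧ R.IsClique (J : Set V) ∧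
      (nonNbrs R S J).card ≤ d * J.card + 1 ∧ nonNbrs R S J ≠ S) Finset.card (by
    obtain ⟨v, hv⟩ := hne
    have h1 : nonNbrs R S {v} = nonNbr R S v := by
      ext x; simp [mem_nonNbrs, mem_nonNbr]
    refine ⟨{v}, Finset.mem_filter.2 ⟨by simpa using hv, by simp, by simp, ?_, ?_⟩⟩
    · simp [h1, hreg v hv]
    · intro h
      rw [← h, h1, hreg v hv] at hqS
      exact hqd hqS)
  simp only [Finset.mem_filter, Finset.mem_powerset] at hJmem hJmax
  obtain ⟨hJS, hJne, hJcl, hJcard, hJcov⟩ := hJmem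
  set N := nonNbrs R S J with hN
  have hNS : N ⊂ S := Finset.ssubset_iff_subset_ne.2 ⟨nonNbrs_subset, hJcov⟩
  obtain ⟨w, hw, x, hx, hxw⟩ := hconn N hNS (hJne.mono (subset_nonNbrs hJS))
  obtain ⟨hw1, hw2, hw3⟩ := hinsert J hJS hJcl w hw
  have hwS := (Finset.mem_sdiff.1 hw).1
  have hxS := hNS.1 hx
  -- Since `x` is already in `N`, adding `w` contributes at most `d` new vertices, so by maximality
  -- `insert w J` leaves nothing of `S` uncovered.
  have hsub : nonNbrs R S (insert w J) ⊆ N ∪ (nonNbr R S w).erase x := by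
    intro y hy
    rw [Finset.mem_union, or_iff_not_imp_left]
    intro hyN
    obtain ⟨hyS, v, hv, hvy⟩ := mem_nonNbrs.1 hy
    rcases Finset.mem_insert.1 hv with rfl | hv
    · exact Finset.mem_erase.2 ⟨fun h => hyN (h ▸ hx), mem_nonNbr.2 ⟨hyS, hvy⟩⟩
    · exact absurd (mem_nonNbrs.2 ⟨hyS, v, hv, hvy⟩) hyN
  have herase : ((nonNbr R S w).erase x).card = d := by
    rw [Finset.card_erase_of_mem (mem_nonNbr.2 ⟨hxS, fun h => hxw h.symm⟩), hreg w hwS]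
    rfl
  have hcov : nonNbrs R S (insert w J) = S := by
    by_contra hcov
    have h1 := Finset.card_le_card hsub
    have h2 := Finset.card_union_le N ((nonNbr R S w).erase x)
    have := hJmax _ ⟨hw1, by simp, hw2, by rw [hw3, mul_add]; omega, hcov⟩
    omega
  set T := S \ N with hT
  have hTS : T ⊆ S := Finset.sdiff_subset
  have hTN : T.card + N.card = S.card := Finset.card_sdiff_add_card_eq_card hNS.1
  have hTle : T.card ≤ d := by
    rw [← herase]
    refine Finset.card_le_card fun y hy => ?_
    have hy' := Finset.mem_sdiff.1 hy
    exact (Finset.mem_union.1 (hsub (hcov.symm ▸ hy'.1))).resolve_left hy'.2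
  have hSgt := hno' _ hw1 hw2
  rw [hw3, mul_add] at hSgt
  have hTc : T.card = d := by omega
  have hSc : S.card = d * (J.card + 1) + 1 := by rw [mul_add]; omega
  -- A red edge in `T` would extend `J` by two vertices, too large a clique for `|S| = d(|J| + 1) +
  -- 1`.
  have hTclique : ∀ y ∈ T, ∀ z ∈ T, ¬ R.Adj y z := by
    intro y hy z hz hyz
    obtain ⟨h1, h2, h3⟩ := hinsert J hJS hJcl y hy
    obtain ⟨h4, h5, h6⟩ := hinsert _ h1 h2 z (by
      rw [Finset.mem_sdiff] at hz ⊢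
      refine ⟨hz.1, fun hcon => ?_⟩
      obtain ⟨-, v, hv, hvz⟩ := mem_nonNbrs.1 hcon
      rcases Finset.mem_insert.1 hv with rfl | hv
      · exact hvz hyz
      · exact hz.2 (mem_nonNbrs.2 ⟨hz.1, v, hv, hvz⟩))
    have := hno' _ h4 h5
    rw [h6, h3, hSc, mul_add, mul_add] at this
    omega
  have hqd' : ¬ q ∣ d := by
    intro h
    rw [hSc, Nat.dvd_add_right (h.mul_right _)] at hqS
    have := Nat.le_of_dvd one_pos hqS
    omega
  have hq3 : 3 ≤ q := by
    by_contra hlt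
    obtain rfl : q = 2 := by omega
    omega
  have hTnon : ∀ y ∈ T, T ⊆ nonNbr R S y := fun y hy z hz =>
    mem_nonNbr.2 ⟨hTS hz, hTclique y hy z hz⟩
  -- As `q ∤ d = |T|`, the set `T` is not a union of blue components.
  obtain ⟨a, ha, z, hz, haz, hzT⟩ : ∃ a ∈ T, ∃ z ∈ S, B.Adj a z ∧ z ∉ T := by
    by_contra hcon
    push Not at hcon
    exact hqd' (hTc ▸ hdvd T hTS hcon)
  have hcins : (insert z T).card = d + 1 := by rw [Finset.card_insert_of_notMem hzT, hTc]
  have heq : ∀ y ∈ T, ¬ R.Adj y z → insert z T = nonNbr R S y := by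
    intro y hy hyz
    refine Finset.eq_of_subset_of_card_le
      (Finset.insert_subset (mem_nonNbr.2 ⟨hz, hyz⟩) (hTnon y hy)) ?_
    rw [hreg y (hTS hy), hcins]
  obtain ⟨b, hb, hbz⟩ : ∃ b ∈ nbrIn B S a, b ∉ ({z} : Finset V) := by
    refine Finset.exists_mem_notMem_of_card_lt_card ?_
    rw [hcard a (hTS ha), Finset.card_singleton]
    omega
  rw [mem_nbrIn] at hb
  rw [Finset.mem_singleton] at hbz
  have hbT : b ∈ T := by
    have : b ∈ insert z T := by
      rw [heq a ha (hBR _ _ haz)]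
      exact mem_nonNbr.2 ⟨hb.1, hBR _ _ hb.2⟩
    exact (Finset.mem_insert.1 this).resolve_left hbz
  have hbzR : ¬ R.Adj b z := hBR _ _ (htrans b hb.1 a (hTS ha) z hz hb.2 haz hbz)
  -- Otherwise `insert z T`, of size `d + 1`, would be a union of blue components.
  obtain ⟨c, hc, hcz⟩ : ∃ c ∈ T, R.Adj c z := by
    by_contra hcon
    push Not at hcon
    have hzeq : insert z T = nonNbr R S z := by
      refine Finset.eq_of_subset_of_card_le ?_ (by rw [hreg z hz, hcins])
      refine Finset.insert_subset (mem_nonNbr.2 ⟨hz, R.loopless.irrefl z⟩) fun y hy =>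
        mem_nonNbr.2 ⟨hTS hy, fun h => hcon y hy h.symm⟩
    refine hqd (hcins ▸ hdvd (insert z T) (Finset.insert_subset hz hTS) ?_)
    intro v hv u hu hvu
    have : u ∈ nonNbr R S v := mem_nonNbr.2 ⟨hu, hBR _ _ hvu⟩
    rcases Finset.mem_insert.1 hv with rfl | hv
    · rwa [hzeq]
    · rwa [heq v hv (hcon v hv)]
  -- The red edge `cz` has common non-neighbours `a` and `b`, so it misses at most `2(d + 1) - 2 =
  -- 2d` vertices, contradicting `hbig`.
  have hlt := hbig {c, z} (by
    intro y hy
    rcases Finset.mem_insert.1 hy with rfl | hy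
    · exact hTS hc
    · exact Finset.mem_singleton.1 hy ▸ hz) (by simp) (by
    rw [Finset.coe_pair, SimpleGraph.isClique_pair]
    exact fun _ => hcz)
  have hcov2 : nonNbrs R S {c, z} ⊆ nonNbr R S c ∪ nonNbr R S z := by
    intro y hy
    obtain ⟨hyS, v, hv, hvy⟩ := mem_nonNbrs.1 hy
    rcases Finset.mem_insert.1 hv with rfl | hv
    · exact Finset.mem_union_left _ (mem_nonNbr.2 ⟨hyS, hvy⟩)
    · rw [Finset.mem_singleton.1 hv] at hvy
      exact Finset.mem_union_right _ (mem_nonNbr.2 ⟨hyS, hvy⟩)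
  have hinter : ({a, b} : Finset V) ⊆ nonNbr R S c ∩ nonNbr R S z := by
    intro y hy
    have hyT : y ∈ T ∧ ¬ R.Adj y z := by
      rcases Finset.mem_insert.1 hy with rfl | hy
      · exact ⟨ha, hBR _ _ haz⟩
      · rw [Finset.mem_singleton.1 hy]
        exact ⟨hbT, hbzR⟩
    exact Finset.mem_inter.2 ⟨hTnon c hc hyT.1, mem_nonNbr.2 ⟨hTS hyT.1, fun h => hyT.2 h.symm⟩⟩
  have h1 := Finset.card_le_card hcov2
  have h2 := Finset.card_le_card hinter
  have h3 := Finset.card_union_add_card_inter (nonNbr R S c) (nonNbr R S z)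
  rw [Finset.card_pair hb.2.ne] at h2
  rw [hreg c (hTS hc), hreg z hz] at h3
  rw [Finset.card_pair hcz.ne] at hlt
  omega

end

/-- If `B` has no path on `q + 1` vertices and every vertex is, apart from at most `D` vertices
(itself included), adjacent to all others in `R` or `B`, then every vertex set `S` contains a
clique of `R` of size at least `|S| / d`. -/
lemma exists_clique_of_pathFree {V : Type*} {R B : SimpleGraph V} {S : Finset V} {d q D : ℕ}
    (hBR : ∀ u v, B.Adj u v → ¬ R.Adj u v)
    (hfree : ∀ S l, IsPathList B S l → l.length ≠ q + 1)
    (hD : ∀ v, ∀ T : Finset V, (∀ u ∈ T, ¬ R.Adj v u ∧ ¬ B.Adj v u) → T.card ≤ D)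
    (hq : 1 ≤ q) (hDq : D + q ≤ d + 1 ∨ (D + q ≤ d + 2 ∧ ¬ q ∣ d + 1)) :
    ∃ Q ⊆ S, R.IsClique (Q : Set V) ∧ S.card ≤ d * Q.card := by
  classical
  induction S using Finset.strongInduction with
  | H S ih =>
    rcases S.eq_empty_or_nonempty with rfl | hne
    · exact ⟨∅, by simp, by simp, by simp⟩
    by_cases hlow : ∃ v ∈ S, (nonNbr R S v).card ≤ d
    · obtain ⟨v, hv, hvd⟩ := hlow
      refine exists_clique_of_card_nonNbrs_le ih (Finset.singleton_subset_iff.2 hv) (by simp)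
        (by simp) ?_
      have h1 : nonNbrs R S {v} = nonNbr R S v := by
        ext x; simp [mem_nonNbrs, mem_nonNbr]
      simpa [h1] using hvd
    push Not at hlow
    have hle : ∀ v ∈ S, (nonNbr R S v).card ≤ D + (nbrIn B S v).card := by
      intro v hv
      have h1 : nonNbr R S v ⊆ (nonNbr R S v \ nbrIn B S v) ∪ nbrIn B S v := by simp
      refine (Finset.card_le_card h1).trans ((Finset.card_union_le _ _).trans ?_)
      refine Nat.add_le_add_right (hD v _ fun u hu => ?_) _
      rw [Finset.mem_sdiff, mem_nonNbr, mem_nbrIn] at hu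
      exact ⟨hu.1.2, fun h => hu.2 ⟨hu.1.1, h⟩⟩
    rcases hDq with hDq | ⟨hDq, hqd⟩
    · exfalso
      obtain ⟨v, hv⟩ := hne
      obtain ⟨p, hp, hpl⟩ := (isPathList_singleton (B := B) hv).exists_append (m := q)
        (fun u hu => by have := hle u hu; have := hlow u hu; omega) (by simp) (by simp)
      exact hfree S _ hp hpl
    · have hq2 : 2 ≤ q := by
        by_contra hlt
        obtain rfl : q = 1 := by omega
        exact hqd (one_dvd _)
      have hdeg : ∀ v ∈ S, q - 1 ≤ (nbrIn B S v).card := fun u hu => by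
        have := hle u hu
        have := hlow u hu
        omega
      have hcard := fun v hv => card_nbrIn_of_pathFree (v := v) hq2 (hfree S) hdeg hv
      refine exists_clique_of_regular hq2 hqd hne ih hBR ?_ hcard fun u hu v hv w hw =>
        adj_trans_of_pathFree hq2 (hfree S) hdeg hu hv hw
      intro v hv
      have h1 := hle v hv
      have h2 := hlow v hv
      rw [hcard v hv] at h1
      omega

/-! ### Arithmetic of the ceilings -/

lemma ceil_arithmetic {r q k n : ℕ} (hr : 1 ≤ r) (hkq : q ≤ k + 2)
    (hlower : r * q * k < n) (hupper : n ≤ r * q * (k + 1)) :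
    ∃ d D : ℕ, ⌈((k : ℚ) / ((k : ℚ) + 1)) * (⌈(n : ℚ) / (r : ℚ)⌉ : ℚ)⌉ = (D : ℤ) ∧ d * r < n ∧
      (D + q ≤ d + 1 ∨ (D + q ≤ d + 2 ∧ ¬ q ∣ d + 1)) := by
  have hr0 : (0 : ℚ) < r := by exact_mod_cast hr
  have hk0 : (0 : ℚ) < (k : ℚ) + 1 := by positivity
  obtain ⟨N, hN⟩ : ∃ N : ℕ, ⌈(n : ℚ) / (r : ℚ)⌉ = (N : ℤ) :=
    ⟨_, (Int.toNat_of_nonneg (Int.ceil_nonneg (by positivity))).symm⟩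
  have hNl : q * k < N := by
    have : ((q * k : ℕ) : ℤ) < ⌈(n : ℚ) / (r : ℚ)⌉ := by
      rw [Int.lt_ceil, lt_div_iff₀ hr0]
      have : ((r * q * k : ℕ) : ℚ) < n := by exact_mod_cast hlower
      push_cast at this ⊢
      linarith
    rw [hN] at this
    exact_mod_cast this
  have hNu : N ≤ q * (k + 1) := by
    have : ⌈(n : ℚ) / (r : ℚ)⌉ ≤ ((q * (k + 1) : ℕ) : ℤ) := by
      rw [Int.ceil_le, div_le_iff₀ hr0]
      have : (n : ℚ) ≤ ((r * q * (k + 1) : ℕ) : ℚ) := by exact_mod_cast hupper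
      push_cast at this ⊢
      linarith
    rw [hN] at this
    exact_mod_cast this
  obtain ⟨d, rfl⟩ : ∃ d, N = d + 1 := ⟨N - 1, by omega⟩
  have hdn : d * r < n := by
    have : (d : ℤ) < ⌈(n : ℚ) / (r : ℚ)⌉ := by rw [hN]; push_cast; omega
    rw [Int.lt_ceil, lt_div_iff₀ hr0] at this
    exact_mod_cast this
  rw [hN]
  obtain ⟨D, hD⟩ : ∃ D : ℕ,
      ⌈((k : ℚ) / ((k : ℚ) + 1)) * (((d + 1 : ℕ) : ℤ) : ℚ)⌉ = (D : ℤ) :=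
    ⟨_, (Int.toNat_of_nonneg (Int.ceil_nonneg (by positivity))).symm⟩
  have hDle : ∀ E : ℕ, k * (d + 1) ≤ (k + 1) * E → D ≤ E := by
    intro E hE
    have : ⌈((k : ℚ) / ((k : ℚ) + 1)) * (((d + 1 : ℕ) : ℤ) : ℚ)⌉ ≤ (E : ℤ) := by
      rw [Int.ceil_le, div_mul_eq_mul_div, div_le_iff₀ hk0]
      have : ((k * (d + 1) : ℕ) : ℚ) ≤ (((k + 1) * E : ℕ) : ℚ) := by exact_mod_cast hE
      push_cast at this ⊢
      linarith
    rw [hD] at this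
    exact_mod_cast this
  refine ⟨d, D, hD, hdn, ?_⟩
  rcases hNu.eq_or_lt with heq | hlt
  · left
    have := hDle (q * k) (by rw [heq]; exact le_of_eq (by ring))
    rw [heq, mul_add]
    omega
  · right
    constructor
    · rcases Nat.lt_or_ge (d + 2) q with h | h
      · exfalso
        nlinarith
      -- With `e = d + 2 - q` the bound needed is `(q - 1)(k + 1) ≤ d + 1`, which follows from `qk <
      -- d + 1` and `q ≤ k + 2`; this is the role of `k ≥ t - 3`.
      · obtain ⟨e, he⟩ := Nat.exists_eq_add_of_le h
        have := hDle e (by nlinarith)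
        omega
    -- `d + 1` lies strictly between the consecutive multiples `qk` and `q(k + 1)`.
    · rintro ⟨m, hm⟩
      rw [hm] at hNl hlt
      have h1 := Nat.lt_of_mul_lt_mul_left hNl
      have h2 := Nat.lt_of_mul_lt_mul_left hlt
      omega

/-! ### The Ramsey statement -/

theorem theorem1p4 {V : Type*} [Fintype V] (G : SimpleGraph V) [DecidableRel G.Adj]
    (r t k n : ℕ) (hr : 2 ≤ r) (hk : 1 ≤ k) (hkt : (t : ℤ) - 3 ≤ (k : ℤ))
    (hn : Fintype.card V = n)
    (hlower : ((r : ℤ) - 1) * ((t : ℤ) - 1) * (k : ℤ) < (n : ℤ))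
    (hupper : (n : ℤ) ≤ ((r : ℤ) - 1) * ((t : ℤ) - 1) * ((k : ℤ) + 1))
    (hdeg : (n : ℤ) - ⌈((k : ℚ) / ((k : ℚ) + 1)) * (⌈(n : ℚ) / ((r : ℚ) - 1)⌉ : ℚ)⌉
      ≤ (G.minDegree : ℤ)) :
    RamseyArrow G (SimpleGraph.completeGraph (Fin r)) (SimpleGraph.pathGraph t) := by
  classical
  -- The bounds on `n` exclude `t ≤ 1`. Here `q = t - 2`, so the lemmas are applied with `q + 1`.
  obtain ⟨q, rfl⟩ : ∃ q, t = q + 2 := by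
    refine ⟨t - 2, ?_⟩
    by_contra hne
    have ht : t = 0 ∨ t = 1 := by omega
    have hr' : (0 : ℤ) < (r : ℤ) - 1 := by omega
    rcases ht with rfl | rfl
    · push_cast at hupper
      nlinarith
    · push_cast at hupper hlower
      linarith
  obtain ⟨r, rfl⟩ : ∃ s, r = s + 1 := ⟨r - 1, by omega⟩
  have hlow' : r * (q + 1) * k < n := by
    have : ((r * (q + 1) * k : ℕ) : ℤ) < n := by push_cast at hlower ⊢; linarith
    exact_mod_cast this
  have hupp' : n ≤ r * (q + 1) * (k + 1) := by
    have : (n : ℤ) ≤ ((r * (q + 1) * (k + 1) : ℕ) : ℤ) := by push_cast at hupper ⊢; linarith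
    exact_mod_cast this
  obtain ⟨d, D, hceil, hdn, hDq⟩ :=
    ceil_arithmetic (by omega) (by push_cast at hkt; omega) hlow' hupp'
  have hcast : ((r + 1 : ℕ) : ℚ) - 1 = r := by push_cast; ring
  rw [hcast, hceil] at hdeg
  intro C
  by_contra hcon
  rw [not_or] at hcon
  obtain ⟨hred, hblue⟩ := hcon
  obtain ⟨Q, -, hQcl, hQc⟩ := exists_clique_of_pathFree (R := C.labelGraph true)
    (B := C.labelGraph false) (S := Finset.univ) (d := d) (q := q + 1) (D := D) (by
      intro u v h1 h2
      rw [SimpleGraph.EdgeLabeling.labelGraph_adj] at h1 h2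
      obtain ⟨_, h1⟩ := h1
      obtain ⟨_, h2⟩ := h2
      simp [h1] at h2) (by
      intro S l hl hlen
      have := hl.pathGraph_isContained
      rw [hlen] at this
      exact hblue this) (by
      intro v T hT
      have h1 : Disjoint T (G.neighborFinset v) := by
        rw [Finset.disjoint_left]
        intro u hu huv
        rw [SimpleGraph.mem_neighborFinset] at huv
        have h2 := hT u hu
        simp only [SimpleGraph.EdgeLabeling.labelGraph_adj, not_exists] at h2
        have h3 := h2.1 huv
        have h4 := h2.2 huv
        cases hC : C ⟨s(v, u), huv⟩ <;> simp_all
      have h2 := Finset.card_le_univ (T ∪ G.neighborFinset v)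
      rw [Finset.card_union_of_disjoint h1, SimpleGraph.card_neighborFinset_eq_degree, hn] at h2
      have h3 := G.minDegree_le_degree v
      omega) (by omega) hDq
  rw [Finset.card_univ, hn] at hQc
  have hrQ : r + 1 ≤ Q.card := by
    have : d * r < d * Q.card := hdn.trans_le hQc
    exact Nat.lt_of_mul_lt_mul_left this
  obtain ⟨Q', hQ', hcard⟩ := Finset.exists_subset_card_eq hrQ
  refine hred ((SimpleGraph.not_cliqueFree_iff_top_isContained _).1 fun hfree => ?_)
  exact hfree Q' ⟨hQcl.subset (by exact_mod_cast hQ'), hcard⟩
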